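/- Let $(M,g)$ be a smooth Riemannian manifold of dimension $n\ge 1$, let $I\subseteq\mathbb R$ be an open interval with the metric $g_I=-dt^2$, and let $f:M\to(0,\infty)$ and $\sigma:I\to(0,\infty)$ be smooth. Let $\bar M={}_fI\times_\sigma M$ be the doubly warped space-time, that is, $\bar M=I\times M$ with the metric $\bar g=-f^2\,dt^2\oplus\sigma^2 g$. Let $h:I\to\mathbb R$ be smooth, let $\zeta$ be a smooth vector field on $M$, and put $\bar\zeta=h\,\partial_t+\zeta$. Suppose that $(\bar M,\bar g,\bar\zeta,\lambda)$ is a Ricci soliton, $$\tfrac12\,\mathcal L_{\bar\zeta}\bar g+\overline{\mathrm{Ric}}=\lambda\,\bar g\qquad(\lambda\in\mathbb R\text{ constant}),$$ and that $\bar\zeta$ is a conformal vector field on $\bar M$ with factor $2\rho$, i.e. $\mathcal L_{\bar\zeta}\bar g=2\rho\,\bar g$ for a smooth function $\rho$ on $\bar M$. If $f$ is constant, then $(M,g)$ is an Einstein manifold, $\mathrm{Ric}=\mu\,g$ with a constant $\mu$, and its factor is given by $$\mu=(\lambda-\rho)\,\sigma^2+\frac{\sigma^\diamond}{f^2}\qquad\text{at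 every point of }I\times M,$$ where $\sigma^\diamond=\sigma\,\Delta^I\sigma+(n-1)\,g_I(\nabla^I\sigma,\nabla^I\sigma)$, with the gradient $\nabla^I$ and the Laplacian $\Delta^I$ of $(I,g_I)$. In particular, $\mu=(\lambda-\rho)\sigma^2+\sigma^\diamond$ if $f=1$. -/

import Mathlib

set_option maxSynthPendingDepth 3

open scoped Manifold ContDiff

noncomputable section

namespace WarpedGeometry

/-- A (not necessarily continuous) field of bilinear forms on the tangent spaces of `M`. The
notions below are applied to smooth, symmetric and nondegenerate such fields, i.e. to
pseudo-Riemannian metrics, on manifolds without boundary. -/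
abbrev BilinField {E H : Type*} [NormedAddCommGroup E] [NormedSpace ℝ E] [TopologicalSpace H]
    (I : ModelWithCorners ℝ E H) (M : Type*) [TopologicalSpace M] [ChartedSpace H M] : Type _ :=
  ∀ p : M, TangentSpace I p →L[ℝ] TangentSpace I p →L[ℝ] ℝ

/-- A (not necessarily continuous) vector field on `M`. -/
abbrev VecField {E H : Type*} [NormedAddCommGroup E] [NormedSpace ℝ E] [TopologicalSpace H]
    (I : ModelWithCorners ℝ E H) (M : Type*) [TopologicalSpace M] [ChartedSpace H M] : Type _ :=
  ∀ p : M, TangentSpace I p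

/-- The pull-back `(u, v) ↦ B (A u, A v)` of a bilinear form. -/
def pullbackForm {E F : Type*} [NormedAddCommGroup E] [NormedSpace ℝ E] [NormedAddCommGroup F]
    [NormedSpace ℝ F] (B : F →L[ℝ] F →L[ℝ] ℝ) (A : E →L[ℝ] F) : E →L[ℝ] E →L[ℝ] ℝ :=
  B.bilinearComp A A

section Geometry

variable {E H M : Type*} [NormedAddCommGroup E] [NormedSpace ℝ E] [TopologicalSpace H]
  [TopologicalSpace M] [ChartedSpace H M] {I : ModelWithCorners ℝ E H}

/-- Smoothness of a vector field, as a section of the tangent bundle. -/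
def VecField.IsSmooth [IsManifold I ∞ M] (Z : VecField I M) : Prop :=
  ContMDiff I I.tangent ∞ (fun p => (⟨p, Z p⟩ : TangentBundle I M))

/-- The coordinate expression of `g` in the preferred chart `φ` at `p`: at the point `x` of the
chart's target it is the pull-back of `g` by `φ⁻¹`, i.e. `(u, v) ↦ g (dφ⁻¹ u, dφ⁻¹ v)`. -/
def coordMetric (g : BilinField I M) (p : M) (x : E) : E →L[ℝ] E →L[ℝ] ℝ :=
  pullbackForm (E := E) (F := E) (g ((extChartAt I p).symm x))
    (mfderiv 𝓘(ℝ, E) I (extChartAt I p).symm x)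

/-- The coordinate expression of the vector field `Z` in the preferred chart `φ` at `p`:
`x ↦ dφ (Z (φ⁻¹ x))`. -/
def coordField (Z : VecField I M) (p : M) (x : E) : E :=
  mfderiv I 𝓘(ℝ, E) (extChartAt I p) ((extChartAt I p).symm x) (Z ((extChartAt I p).symm x))

/-- Twice the Christoffel symbols of the first kind of a metric `G` on an open set of `E`:
`(u, v, w) ↦ (∂_u G)(v, w) + (∂_v G)(u, w) - (∂_w G)(u, v)`; see `christoffelFirst_apply`. -/
def christoffelFirst (G : E → E →L[ℝ] E →L[ℝ] ℝ) (x : E) : E →L[ℝ] E →L[ℝ] E →L[ℝ] ℝ :=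
  let flip : (E →L[ℝ] E →L[ℝ] ℝ) →L[ℝ] (E →L[ℝ] E →L[ℝ] ℝ) :=
    (ContinuousLinearMap.flipₗᵢ ℝ E E ℝ).toContinuousLinearEquiv.toContinuousLinearMap
  fderiv ℝ G x + (fderiv ℝ G x).flip - flip ∘L (fderiv ℝ G x).flip

theorem christoffelFirst_apply (G : E → E →L[ℝ] E →L[ℝ] ℝ) (x u v w : E) :
    christoffelFirst G x u v w
      = fderiv ℝ G x u v w + fderiv ℝ G x v u w - fderiv ℝ G x w u v := by
  simp [christoffelFirst]

/-- The Christoffel symbols `Γ(u, v)` of the Levi-Civita connection of `G`, determined by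
`2 G(Γ(u, v), w) = (∂_u G)(v, w) + (∂_v G)(u, w) - (∂_w G)(u, v)`. -/
def christoffel (G : E → E →L[ℝ] E →L[ℝ] ℝ) (x : E) : E →L[ℝ] E →L[ℝ] E :=
  (2 : ℝ)⁻¹ • ((ContinuousLinearMap.compL ℝ E (E →L[ℝ] ℝ) E (G x).inverse) ∘L
    christoffelFirst G x)

theorem christoffel_apply (G : E → E →L[ℝ] E →L[ℝ] ℝ) (x u v : E) :
    christoffel G x u v = (2 : ℝ)⁻¹ • (G x).inverse (christoffelFirst G x u v) := by
  simp [christoffel]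

/-- The curvature operator `u ↦ R(u, v) w` in coordinates, see `curvature_apply`. -/
def curvature (G : E → E →L[ℝ] E →L[ℝ] ℝ) (x v w : E) : E →L[ℝ] E :=
  ((fderiv ℝ (christoffel G) x).flip v).flip w - (fderiv ℝ (christoffel G) x v).flip w
    + (christoffel G x).flip (christoffel G x v w)
    - (christoffel G x v) ∘L ((christoffel G x).flip w)

theorem curvature_apply (G : E → E →L[ℝ] E →L[ℝ] ℝ) (x u v w : E) :
    curvature G x v w u
      = fderiv ℝ (christoffel G) x u v w - fderiv ℝ (christoffel G) x v u w
        + christoffel G x u (christoffel G x v w) - christoffel G x v (christoffel G x u w) := by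
  simp [curvature]

/-- The Ricci tensor of `g` at `p`, `Ric(v, w) = tr (u ↦ R(u, v) w)`. It is computed in the
preferred chart `φ` at `p`; the tangent space at `p` is the model space `E`, a tangent vector
being identified with its coordinates in that chart (so that `dφ` is the identity at `p`). -/
def ricci (g : BilinField I M) (p : M) (v w : TangentSpace I p) : ℝ :=
  LinearMap.trace ℝ E (curvature (coordMetric g p) (extChartAt I p p) v w : E →ₗ[ℝ] E)

/-- The Lie derivative `L_Z g` at `p`: in coordinates
`(L_Z g)(u, v) = (∂_Z g)(u, v) + g(∂_u Z, v) + g(u, ∂_v Z)`. -/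
def lieDerivative (Z : VecField I M) (g : BilinField I M) (p : M) (u v : TangentSpace I p) : ℝ :=
  let x : E := extChartAt I p p
  fderiv ℝ (coordMetric g p) x (coordField Z p x) u v
    + coordMetric g p x (fderiv ℝ (coordField Z p) x u) v
    + coordMetric g p x u (fderiv ℝ (coordField Z p) x v)

/-- The gradient of `f`, determined by `g(∇f, v) = df(v)`. -/
def gradient (g : BilinField I M) (f : M → ℝ) : VecField I M :=
  fun p => (g p).inverse (mfderiv I 𝓘(ℝ, ℝ) f p : TangentSpace I p →L[ℝ] ℝ)

/-- The Hessian `H^f(u, v) = ∂_u ∂_v f - df(Γ(u, v))` of `f` at `p`, in the preferred chart. -/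
def hessian (g : BilinField I M) (f : M → ℝ) (p : M) : E →L[ℝ] E →L[ℝ] ℝ :=
  let x : E := extChartAt I p p
  let F : E → ℝ := f ∘ (extChartAt I p).symm
  fderiv ℝ (fderiv ℝ F) x
    - (ContinuousLinearMap.compL ℝ E E ℝ (fderiv ℝ F x)) ∘L christoffel (coordMetric g p) x

/-- The Laplacian `Δf`: the trace of the Hessian with respect to `g`. -/
def laplacian (g : BilinField I M) (f : M → ℝ) (p : M) : ℝ :=
  LinearMap.trace ℝ E ((g p).inverse ∘L hessian g f p : E →L[ℝ] E)

/-- `f^⋄ = f Δf + (m - 1) g(∇f, ∇f)`, where `m` is the dimension of the other factor. -/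
def diamond (g : BilinField I M) (m : ℕ) (f : M → ℝ) (p : M) : ℝ :=
  f p * laplacian g f p + ((m : ℝ) - 1) * g p (gradient g f p) (gradient g f p)

/-- `Z` is a (smooth) conformal vector field with `L_Z g = κ g`. -/
def IsConformal [IsManifold I ∞ M] (g : BilinField I M) (Z : VecField I M) (κ : M → ℝ) : Prop :=
  Z.IsSmooth ∧ ContMDiff I 𝓘(ℝ, ℝ) ∞ κ ∧
    ∀ (p : M) (u v : TangentSpace I p), lieDerivative Z g p u v = κ p * g p u v

/-- `(M, g, Z, lam)` is a Ricci soliton: `½ L_Z g + Ric = lam g` with a constant `lam`. -/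
def IsRicciSoliton [IsManifold I ∞ M] (g : BilinField I M) (Z : VecField I M) (lam : ℝ) : Prop :=
  Z.IsSmooth ∧
    ∀ (p : M) (u v : TangentSpace I p),
      (1 / 2) * lieDerivative Z g p u v + ricci g p u v = lam * g p u v

/-- `(M, g)` is an Einstein manifold with factor `μ`: `Ric = μ g` with a constant `μ`. -/
def IsEinstein (g : BilinField I M) (μ : ℝ) : Prop :=
  ∀ (p : M) (u v : TangentSpace I p), ricci g p u v = μ * g p u v

end Geometry

section Products

variable {E₁ H₁ M₁ E₂ H₂ M₂ : Type*}
  [NormedAddCommGroup E₁] [NormedSpace ℝ E₁] [TopologicalSpace H₁]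
  [TopologicalSpace M₁] [ChartedSpace H₁ M₁]
  [NormedAddCommGroup E₂] [NormedSpace ℝ E₂] [TopologicalSpace H₂]
  [TopologicalSpace M₂] [ChartedSpace H₂ M₂]
  {I₁ : ModelWithCorners ℝ E₁ H₁} {I₂ : ModelWithCorners ℝ E₂ H₂}

/-- The doubly warped product metric `(f₂ ∘ π₂)² π₁^* g₁ ⊕ (f₁ ∘ π₁)² π₂^* g₂` on `M₁ × M₂`. The
tangent space of `M₁ × M₂` at `(p₁, p₂)` is the product of the two tangent spaces, and the
differentials of `π₁`, `π₂` are the projections. -/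
def doublyWarped (g₁ : BilinField I₁ M₁) (g₂ : BilinField I₂ M₂) (f₁ : M₁ → ℝ) (f₂ : M₂ → ℝ) :
    BilinField (I₁.prod I₂) (M₁ × M₂) :=
  fun p =>
    (f₂ p.2) ^ 2 • pullbackForm (E := E₁ × E₂) (F := E₁) (g₁ p.1) (ContinuousLinearMap.fst ℝ E₁ E₂)
    + (f₁ p.1) ^ 2 •
        pullbackForm (E := E₁ × E₂) (F := E₂) (g₂ p.2) (ContinuousLinearMap.snd ℝ E₁ E₂)

/-- The sum of the lifts of two vector fields to the product. -/
def sumLift (Z₁ : VecField I₁ M₁) (Z₂ : VecField I₂ M₂) :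
    VecField (I₁.prod I₂) (M₁ × M₂) :=
  fun p => (Z₁ p.1, Z₂ p.2)

end Products

/-- The metric `-dt²` on an open subset of the line. -/
def minusDtSq (J : TopologicalSpace.Opens ℝ) : BilinField 𝓘(ℝ, ℝ) J :=
  fun _ => -(ContinuousLinearMap.mul ℝ ℝ)

/-- The vector field `h ∂_t` on an open subset of the line. -/
def hdt {J : TopologicalSpace.Opens ℝ} (h : J → ℝ) : VecField 𝓘(ℝ, ℝ) J :=
  fun t => (h t : ℝ)

/-- The doubly warped space-time metric `-f² dt² ⊕ σ² g` on `J × M`. -/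
def spacetimeMetric {E H M : Type*} [NormedAddCommGroup E] [NormedSpace ℝ E]
    [TopologicalSpace H] [TopologicalSpace M] [ChartedSpace H M] {I : ModelWithCorners ℝ E H}
    (J : TopologicalSpace.Opens ℝ) (g : BilinField I M) (f : M → ℝ) (σ : J → ℝ) :
    BilinField (𝓘(ℝ, ℝ).prod I) (J × M) :=
  doublyWarped (minusDtSq J) g σ f

end WarpedGeometry

end

/-!
With `f = c` constant, the space-time metric is `-c² dt² + σ² g`. Subtracting the conformal equation
from the soliton equation removes the Lie derivative and leaves `Ric = (lam - ρ) ḡ` on `J × M`.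
The theorem then follows from the two diagonal blocks of the Ricci tensor of this warped product.

* `ricci_spacetimeMetric_line`: `Ric(∂_t, ∂_t) = -n σ'' / σ`. Compared with
  `(lam - ρ) ḡ(∂_t, ∂_t) = -(lam - ρ) c²`, this shows that `ρ` depends on `t` only. It is this step,
  and not a Schur-type lemma, that makes the Einstein factor constant; so the argument needs neither
  connectedness of `M` nor `n ≥ 3`.
* `ricci_spacetimeMetric_fibre`: `Ric(v, w) = Ric_M(v, w) - σ^⋄ / c² g(v, w)` for `v`, `w` tangent
  to `M`. Compared with `(lam - ρ) σ² g(v, w)`, this gives `Ric_M = μ(t) g` with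
  `μ(t) = (lam - ρ) σ² + σ^⋄ / c²`; since `Ric_M` does not involve `t` and `g ≠ 0`, neither
  does `μ`.

Both blocks are computed in a product chart. There the metric is `warpedModel c s G`, with `s` and
`G` the coordinate expressions of `σ` and `g`, and its Christoffel symbols are
`Γ((a, u), (b, v)) = (s s' / c² G(u, v), s' / s (a v + b u) + Γ_G(u, v))`
(`christoffel_warpedModel`). One more derivative gives the curvature, whose trace splits into the
traces of the diagonal blocks (`trace_real_prod`).
-/

namespace WarpedGeometry

open scoped Topology

section Coordinates

variable {E : Type*} [NormedAddCommGroup E] [NormedSpace ℝ E]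

/-! ### Linear algebra and smoothness of operator-valued maps -/

theorem isInvertible_of_nondegenerate [FiniteDimensional ℝ E] {B : E →L[ℝ] E →L[ℝ] ℝ}
    (hB : ∀ u, B u = 0 → u = 0) :
    B.IsInvertible := by
  have hinj : Function.Injective (B : E →ₗ[ℝ] E →L[ℝ] ℝ) :=
    (injective_iff_map_eq_zero (B : E →ₗ[ℝ] E →L[ℝ] ℝ)).2 hB
  have hdim : Module.finrank ℝ E = Module.finrank ℝ (E →L[ℝ] ℝ) := by
    rw [← (LinearMap.toContinuousLinearMap (𝕜 := ℝ) (E := E) (F' := ℝ)).finrank_eq]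
    exact (Subspace.dual_finrank_eq (K := ℝ) (V := E)).symm
  exact ⟨(LinearEquiv.ofInjectiveOfFinrankEq _ hinj hdim).toContinuousLinearEquiv, by
    ext u v; rfl⟩

/-- The trace of an endomorphism of `ℝ × E` is the sum of the traces of its diagonal blocks. -/
theorem trace_real_prod [FiniteDimensional ℝ E] (T : ℝ × E →ₗ[ℝ] ℝ × E) :
    LinearMap.trace ℝ (ℝ × E) T = (T (1, 0)).1
      + LinearMap.trace ℝ E (LinearMap.snd ℝ ℝ E ∘ₗ T ∘ₗ LinearMap.inr ℝ ℝ E) := by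
  have hT : T = (T ∘ₗ LinearMap.inl ℝ ℝ E) ∘ₗ LinearMap.fst ℝ ℝ E
      + (T ∘ₗ LinearMap.inr ℝ ℝ E) ∘ₗ LinearMap.snd ℝ ℝ E := by
    have h0 : T (0, 0) = 0 := map_zero T
    ext <;> simp [h0]
  conv_lhs => rw [hT]
  rw [map_add, LinearMap.trace_comp_comm', LinearMap.trace_comp_comm' (LinearMap.snd ℝ ℝ E)]
  congr 1
  have : LinearMap.fst ℝ ℝ E ∘ₗ T ∘ₗ LinearMap.inl ℝ ℝ E = (T (1, 0)).1 • LinearMap.id := by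
    ext; simp
  rw [this]; simp

theorem contDiffAt_deriv {s : ℝ → ℝ} {t : ℝ} (hs : ContDiffAt ℝ ∞ s t) :
    ContDiffAt ℝ ∞ (deriv s) t :=
  (hs.fderiv_right (m := ∞) (by simp)).clm_apply contDiffAt_const

/-- A family of operators on a finite-dimensional space is as smooth as its values at each
vector. -/
theorem contDiffAt_of_clm_apply [FiniteDimensional ℝ E]
    {D F : Type*} [NormedAddCommGroup D] [NormedSpace ℝ D]
    [NormedAddCommGroup F] [NormedSpace ℝ F] {f : D → E →L[ℝ] F} {x : D} {n : ℕ∞ω}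
    (hf : ∀ v, ContDiffAt ℝ n (fun y => f y v) x) : ContDiffAt ℝ n f x := by
  let d := Module.finrank ℝ E
  have hd : d = Module.finrank ℝ (Fin d → ℝ) := (Module.finrank_fin_fun ℝ).symm
  let e₁ := ContinuousLinearEquiv.ofFinrankEq hd
  let e₂ := (e₁.arrowCongr (1 : F ≃L[ℝ] F)).trans (ContinuousLinearEquiv.piRing (Fin d))
  rw [← Function.id_comp f, ← e₂.symm_comp_self]
  exact e₂.symm.contDiff.contDiffAt.comp x (contDiffAt_pi.mpr fun i => hf _)

theorem fderiv_clm_apply_apply {D F : Type*} [NormedAddCommGroup D] [NormedSpace ℝ D]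
    [NormedAddCommGroup F] [NormedSpace ℝ F] {f : D → E →L[ℝ] E →L[ℝ] F} {x : D}
    (hf : DifferentiableAt ℝ f x) (u : D) (v w : E) :
    fderiv ℝ f x u v w = fderiv ℝ (fun y => f y v w) x u := by
  have h := (hf.hasFDerivAt.clm_apply (hasFDerivAt_const v x)).clm_apply (hasFDerivAt_const w x)
  rw [h.fderiv]; simp

/-! ### Christoffel symbols in coordinates -/

variable {G : E → E →L[ℝ] E →L[ℝ] ℝ} {x : E}

theorem two_mul_apply_christoffel (hinv : (G x).IsInvertible) (u v w : E) :
    2 * G x (christoffel G x u v) w = christoffelFirst G x u v w := by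
  rw [christoffel_apply, map_smul, hinv.self_apply_inverse]; simp

/-- The Koszul formula `2 G(z, w) = (∂_u G)(v, w) + (∂_v G)(u, w) - (∂_w G)(u, v)` determines
`z = Γ(u, v)`. It allows Christoffel symbols to be verified without inverting the metric. -/
theorem christoffel_eq_of_forall (hinv : (G x).IsInvertible) {u v z : E}
    (hz : ∀ w, 2 * G x z w = christoffelFirst G x u v w) : christoffel G x u v = z := by
  have : christoffelFirst G x u v = G x ((2 : ℝ) • z) := by
    ext w; rw [← hz w]; simp
  rw [christoffel_apply, this, hinv.inverse_apply_self, smul_smul]; simp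

theorem contDiffAt_christoffel [FiniteDimensional ℝ E]
    (hG : ContDiffAt ℝ ∞ G x) (hinv : (G x).IsInvertible) :
    ContDiffAt ℝ ∞ (christoffel G) x := by
  refine contDiffAt_of_clm_apply fun u => contDiffAt_of_clm_apply fun v => ?_
  simp only [christoffel_apply]
  refine ContDiffAt.const_smul _ (ContDiffAt.clm_apply
    ((hinv.contDiffAt_map_inverse).comp x hG) (contDiffAt_of_clm_apply fun w => ?_))
  simp only [christoffelFirst_apply]
  have hd : ContDiffAt ℝ ∞ (fderiv ℝ G) x := hG.fderiv_right (by simp)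
  have key : ∀ a b c : E, ContDiffAt ℝ ∞ (fun y => fderiv ℝ G y a b c) x := fun a b c =>
    ((hd.clm_apply contDiffAt_const).clm_apply contDiffAt_const).clm_apply contDiffAt_const
  exact ((key _ _ _).add (key _ _ _)).sub (key _ _ _)

theorem eventually_isInvertible [FiniteDimensional ℝ E] (hG : ContinuousAt G x)
    (hinv : (G x).IsInvertible) :
    ∀ᶠ y in 𝓝 x, (G y).IsInvertible := by
  obtain ⟨e, he⟩ := hinv
  exact hG (he ▸ e.nhds)

/-- The curvature depends only on the germ of the metric. -/
theorem curvature_congr {G' : E → E →L[ℝ] E →L[ℝ] ℝ} (hGG' : G =ᶠ[𝓝 x] G') :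
    curvature G x = curvature G' x := by
  have h : christoffel G =ᶠ[𝓝 x] christoffel G' := by
    filter_upwards [hGG'.eventuallyEq_nhds] with y hy
    simp only [christoffel, christoffelFirst, hy.fderiv_eq, hy.eq_of_nhds]
  funext v w
  simp only [curvature, h.fderiv_eq, h.eq_of_nhds]

/-! ### The Christoffel symbols of a warped product -/

/-- The metric `-c² dt² + s² G` on (an open subset of) `ℝ × E`. -/
noncomputable def warpedModel (c : ℝ) (s : ℝ → ℝ) (G : E → E →L[ℝ] E →L[ℝ] ℝ) (y : ℝ × E) :
    ℝ × E →L[ℝ] ℝ × E →L[ℝ] ℝ :=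
  c ^ 2 • pullbackForm (-(ContinuousLinearMap.mul ℝ ℝ)) (ContinuousLinearMap.fst ℝ ℝ E)
    + s y.1 ^ 2 • pullbackForm (G y.2) (ContinuousLinearMap.snd ℝ ℝ E)

theorem warpedModel_apply (c : ℝ) (s : ℝ → ℝ) (G : E → E →L[ℝ] E →L[ℝ] ℝ) (y U V : ℝ × E) :
    warpedModel c s G y U V = -c ^ 2 * (U.1 * V.1) + s y.1 ^ 2 * G y.2 U.2 V.2 := by
  simp [warpedModel, pullbackForm]

variable {c : ℝ} {s : ℝ → ℝ} {y : ℝ × E}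

theorem contDiffAt_warpedModel [FiniteDimensional ℝ E] {n : ℕ∞ω} (hs : ContDiffAt ℝ n s y.1)
    (hG : ContDiffAt ℝ n G y.2) : ContDiffAt ℝ n (warpedModel c s G) y := by
  refine contDiffAt_of_clm_apply fun U => contDiffAt_of_clm_apply fun V => ?_
  simp only [warpedModel_apply]
  have h1 : ContDiffAt ℝ n (fun z : ℝ × E => s z.1) y := hs.comp y contDiffAt_fst
  have h2 : ContDiffAt ℝ n (fun z : ℝ × E => G z.2 U.2 V.2) y :=
    ((hG.comp y contDiffAt_snd).clm_apply contDiffAt_const).clm_apply contDiffAt_const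
  exact contDiffAt_const.add ((h1.pow 2).mul h2)

theorem isInvertible_warpedModel [FiniteDimensional ℝ E] (hc : c ≠ 0) (hs : s y.1 ≠ 0)
    (hinv : (G y.2).IsInvertible) :
    (warpedModel c s G y).IsInvertible := by
  refine isInvertible_of_nondegenerate fun U hU => ?_
  have h1 := warpedModel_apply c s G y U (1, 0)
  have h2 : G y.2 U.2 = 0 := by
    ext w
    have := warpedModel_apply c s G y U (0, w)
    simp [hU] at this
    simpa [hs] using this
  simp [hU, hc] at h1
  have h3 : U.2 = 0 := by rw [← hinv.inverse_apply_self U.2, h2, map_zero]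
  exact Prod.ext h1 h3

theorem fderiv_warpedModel_apply (hs : DifferentiableAt ℝ s y.1)
    (hG : DifferentiableAt ℝ G y.2) (U V W : ℝ × E) :
    fderiv ℝ (fun z => warpedModel c s G z V W) y U
      = 2 * s y.1 * deriv s y.1 * U.1 * G y.2 V.2 W.2
        + s y.1 ^ 2 * fderiv ℝ G y.2 U.2 V.2 W.2 := by
  simp only [warpedModel_apply]
  have h1 : HasFDerivAt (fun z : ℝ × E => s z.1) _ y :=
    hs.hasFDerivAt.comp y hasFDerivAt_fst
  have h2 : HasFDerivAt (fun z : ℝ × E => G z.2 V.2 W.2) _ y :=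
    ((hG.hasFDerivAt.comp y hasFDerivAt_snd).clm_apply (hasFDerivAt_const V.2 y)).clm_apply
      (hasFDerivAt_const W.2 y)
  have h3 : HasFDerivAt
      (fun z : ℝ × E => -c ^ 2 * (V.1 * W.1) + s z.1 ^ 2 * G z.2 V.2 W.2) _ y :=
    ((h1.pow 2).mul h2).const_add _
  rw [h3.fderiv]
  have h4 : fderiv ℝ s y.1 U.1 = U.1 * deriv s y.1 := by
    rw [fderiv_eq_smul_deriv, smul_eq_mul]
  simp [h4]
  ring

theorem christoffel_warpedModel [FiniteDimensional ℝ E] (hc : c ≠ 0) (hs0 : s y.1 ≠ 0)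
    (hs : ContDiffAt ℝ 1 s y.1)
    (hG : ContDiffAt ℝ 1 G y.2) (hinv : (G y.2).IsInvertible) (U V : ℝ × E) :
    christoffel (warpedModel c s G) y U V
      = (s y.1 * deriv s y.1 / c ^ 2 * G y.2 U.2 V.2,
          (deriv s y.1 / s y.1) • (U.1 • V.2 + V.1 • U.2) + christoffel G y.2 U.2 V.2) := by
  refine christoffel_eq_of_forall (G := warpedModel c s G)
    (isInvertible_warpedModel hc hs0 hinv) fun W => ?_
  have hd := (contDiffAt_warpedModel (c := c) hs hG).differentiableAt one_ne_zero
  have hs' := hs.differentiableAt one_ne_zero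
  have hG' := hG.differentiableAt one_ne_zero
  have key := two_mul_apply_christoffel hinv U.2 V.2 W.2
  rw [christoffelFirst_apply] at key ⊢
  rw [fderiv_clm_apply_apply hd, fderiv_clm_apply_apply hd, fderiv_clm_apply_apply hd]
  simp only [fderiv_warpedModel_apply hs' hG']
  simp only [warpedModel_apply, map_add, map_smul, add_apply,
    smul_apply, smul_eq_mul]
  field_simp
  linear_combination s y.1 * key

end Coordinates

/-! ### The Ricci curvature of a warped product in coordinates -/

section WarpedCurvature

variable {E : Type*} [NormedAddCommGroup E] [NormedSpace ℝ E] [FiniteDimensional ℝ E]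
  {G : E → E →L[ℝ] E →L[ℝ] ℝ} {c : ℝ} {s : ℝ → ℝ} {y : ℝ × E}

/-- The derivative of `christoffel_warpedModel`: the coefficients `s s' / c²` and `s' / s` have the
derivatives `(s'² + s s'') / c²` and `(s'' s - s'²) / s²`. -/
theorem fderiv_christoffel_warpedModel (hc : c ≠ 0) (hs0 : s y.1 ≠ 0)
    (hs : ContDiffAt ℝ ∞ s y.1) (hG : ContDiffAt ℝ ∞ G y.2) (hinv : (G y.2).IsInvertible)
    (U V W : ℝ × E) :
    fderiv ℝ (christoffel (warpedModel c s G)) y U V W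
      = ((deriv s y.1 ^ 2 + s y.1 * deriv (deriv s) y.1) / c ^ 2 * U.1 * G y.2 V.2 W.2
            + s y.1 * deriv s y.1 / c ^ 2 * fderiv ℝ G y.2 U.2 V.2 W.2,
          ((deriv (deriv s) y.1 * s y.1 - deriv s y.1 ^ 2) / s y.1 ^ 2 * U.1) •
              (V.1 • W.2 + W.1 • V.2)
            + fderiv ℝ (christoffel G) y.2 U.2 V.2 W.2) := by
  have hΓ : DifferentiableAt ℝ (christoffel G) y.2 :=
    (contDiffAt_christoffel hG hinv).differentiableAt (by simp)
  have hΓ' : DifferentiableAt ℝ (christoffel (warpedModel c s G)) y :=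
    (contDiffAt_christoffel (contDiffAt_warpedModel hs hG)
      (isInvertible_warpedModel hc hs0 hinv)).differentiableAt (by simp)
  rw [fderiv_clm_apply_apply hΓ']
  have hs1 : ContDiffAt ℝ 1 s y.1 := hs.of_le (by norm_cast)
  have hG1 : ContDiffAt ℝ 1 G y.2 := hG.of_le (by norm_cast)
  have hev : (fun z => christoffel (warpedModel c s G) z V W) =ᶠ[𝓝 y] fun z =>
      (s z.1 * deriv s z.1 / c ^ 2 * G z.2 V.2 W.2,
        (deriv s z.1 / s z.1) • (V.1 • W.2 + W.1 • V.2) + christoffel G z.2 V.2 W.2) := by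
    filter_upwards [continuousAt_fst.eventually (hs1.eventually (by simp)),
      continuousAt_snd.eventually (hG1.eventually (by simp)),
      continuousAt_fst.eventually (hs1.continuousAt.eventually_ne hs0),
      continuousAt_snd.eventually (eventually_isInvertible hG1.continuousAt hinv)]
      with z h1 h2 h3 h4
    exact christoffel_warpedModel hc h3 h1 h2 h4 V W
  rw [hev.fderiv_eq]
  have hds : HasDerivAt s (deriv s y.1) y.1 := (hs1.differentiableAt one_ne_zero).hasDerivAt
  have hdds : HasDerivAt (deriv s) (deriv (deriv s) y.1) y.1 := 
    ((contDiffAt_deriv hs).differentiableAt (by simp)).hasDerivAt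
  have hk : HasFDerivAt (fun z : ℝ × E => s z.1 * deriv s z.1 / c ^ 2) _ y :=
    (((hds.mul hdds).div_const (c ^ 2)).hasFDerivAt).comp y hasFDerivAt_fst
  have hκ : HasFDerivAt (fun z : ℝ × E => deriv s z.1 / s z.1) _ y :=
    ((hdds.div hds hs0).hasFDerivAt).comp y hasFDerivAt_fst
  have hGd : HasFDerivAt (fun z : ℝ × E => G z.2 V.2 W.2) _ y :=
    (((hG1.differentiableAt one_ne_zero).hasFDerivAt.comp y hasFDerivAt_snd).clm_apply
      (hasFDerivAt_const V.2 y)).clm_apply (hasFDerivAt_const W.2 y)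
  have hΓd : HasFDerivAt (fun z : ℝ × E => christoffel G z.2 V.2 W.2) _ y :=
    ((hΓ.hasFDerivAt.comp y hasFDerivAt_snd).clm_apply
      (hasFDerivAt_const V.2 y)).clm_apply (hasFDerivAt_const W.2 y)
  have htot : HasFDerivAt (fun z : ℝ × E => (s z.1 * deriv s z.1 / c ^ 2 * G z.2 V.2 W.2,
        (deriv s z.1 / s z.1) • (V.1 • W.2 + W.1 • V.2) + christoffel G z.2 V.2 W.2)) _ y :=
    (hk.mul hGd).prodMk ((hκ.smul_const _).add hΓd)
  rw [htot.fderiv]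
  refine Prod.ext ?_ ?_
  · simp
    ring
  · simp
    ring_nf

/-- The line direction of `-c² dt² + s² G`: `Ric(∂_t, ∂_t) = -n s'' / s`. -/
theorem trace_curvature_warpedModel_line (hc : c ≠ 0) (hs0 : s y.1 ≠ 0)
    (hs : ContDiffAt ℝ ∞ s y.1) (hG : ContDiffAt ℝ ∞ G y.2) (hinv : (G y.2).IsInvertible) :
    LinearMap.trace ℝ (ℝ × E)
        (curvature (warpedModel c s G) y (1, 0) (1, 0) : ℝ × E →ₗ[ℝ] ℝ × E)
      = -(Module.finrank ℝ E * (deriv (deriv s) y.1 / s y.1)) := by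
  have hs1 : ContDiffAt ℝ 1 s y.1 := hs.of_le (by norm_cast)
  have hG1 : ContDiffAt ℝ 1 G y.2 := hG.of_le (by norm_cast)
  have hΓ := christoffel_warpedModel hc hs0 hs1 hG1 hinv
  have hdΓ := fderiv_christoffel_warpedModel hc hs0 hs hG hinv
  rw [trace_real_prod]
  have h22 : LinearMap.snd ℝ ℝ E ∘ₗ
      (curvature (warpedModel c s G) y (1, 0) (1, 0) : ℝ × E →ₗ[ℝ] ℝ × E) ∘ₗ
        LinearMap.inr ℝ ℝ E = (-(deriv (deriv s) y.1 / s y.1)) • LinearMap.id := by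
    ext u
    simp [curvature_apply, hΓ, hdΓ, smul_smul]
    have e : deriv (deriv s) y.1 / s y.1
        = (deriv (deriv s) y.1 * s y.1 - deriv s y.1 ^ 2) / s y.1 ^ 2
          + deriv s y.1 / s y.1 * (deriv s y.1 / s y.1) := by
      field_simp
      ring
    rw [e]
    module
  rw [h22]
  simp [curvature_apply, hΓ, hdΓ]
  ring

/-- The directions of `E` for `-c² dt² + s² G`:
`Ric((0, v), (0, w)) = Ric_G(v, w) + (s s'' + (n - 1) s'²) / c² G(v, w)`. -/
theorem trace_curvature_warpedModel_fibre (hc : c ≠ 0) (hs0 : s y.1 ≠ 0)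
    (hs : ContDiffAt ℝ ∞ s y.1) (hG : ContDiffAt ℝ ∞ G y.2) (hinv : (G y.2).IsInvertible)
    (v w : E) :
    LinearMap.trace ℝ (ℝ × E)
        (curvature (warpedModel c s G) y (0, v) (0, w) : ℝ × E →ₗ[ℝ] ℝ × E)
      = LinearMap.trace ℝ E (curvature G y.2 v w : E →ₗ[ℝ] E)
        + (s y.1 * deriv (deriv s) y.1 + (Module.finrank ℝ E - 1) * deriv s y.1 ^ 2) / c ^ 2
          * G y.2 v w := by
  have hs1 : ContDiffAt ℝ 1 s y.1 := hs.of_le (by norm_cast)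
  have hG1 : ContDiffAt ℝ 1 G y.2 := hG.of_le (by norm_cast)
  have hΓ := christoffel_warpedModel hc hs0 hs1 hG1 hinv
  have hdΓ := fderiv_christoffel_warpedModel hc hs0 hs hG hinv
  rw [trace_real_prod]
  -- the block on `E` is `u ↦ R(u, v) w + s'² / c² (G(v, w) u - G(u, w) v)`
  have h22 : LinearMap.snd ℝ ℝ E ∘ₗ
      (curvature (warpedModel c s G) y (0, v) (0, w) : ℝ × E →ₗ[ℝ] ℝ × E) ∘ₗ
        LinearMap.inr ℝ ℝ E = (curvature G y.2 v w : E →ₗ[ℝ] E)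
          + (deriv s y.1 ^ 2 / c ^ 2) • (G y.2 v w • LinearMap.id
            - ((G y.2).flip w : E →ₗ[ℝ] ℝ).smulRight v) := by
    ext u
    simp [curvature_apply, hΓ, hdΓ, smul_smul, smul_sub]
    have e : deriv s y.1 / s y.1 * (s y.1 * deriv s y.1 / c ^ 2)
        = deriv s y.1 ^ 2 / c ^ 2 := by field_simp
    simp only [← mul_assoc, e]
    abel
  have h11 : (curvature (warpedModel c s G) y (0, v) (0, w) (1, 0)).1
      = s y.1 * deriv (deriv s) y.1 / c ^ 2 * G y.2 v w := by
    simp [curvature_apply, hΓ, hdΓ]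
    field_simp
    ring
  rw [h22, ContinuousLinearMap.coe_coe, h11]
  simp only [map_add, map_smul, map_sub, LinearMap.trace_smulRight, ContinuousLinearMap.coe_coe,
    LinearMap.trace_id, smul_eq_mul,
    ContinuousLinearMap.flip_apply]
  ring

end WarpedCurvature

/-! ### Metrics in the preferred charts -/

section Charts

variable {E H M : Type*} [NormedAddCommGroup E] [NormedSpace ℝ E] [TopologicalSpace H]
  [TopologicalSpace M] [ChartedSpace H M] {I : ModelWithCorners ℝ E H}

/-- The tangent space at `φ⁻¹ x` is identified with `E` by its own preferred chart, so the
differential of `φ⁻¹` at `x` is the identity where that chart is again `φ`: at the base point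
`x = φ p` always, and throughout the target for an open subset of the line, which has a single
chart. -/
theorem mfderiv_extChartAt_symm_eq_id [I.Boundaryless] [IsManifold I ∞ M] {p : M} {x : E}
    (hx : x ∈ (extChartAt I p).target)
    (hchart : extChartAt I ((extChartAt I p).symm x) = extChartAt I p) :
    (mfderiv 𝓘(ℝ, E) I (extChartAt I p).symm x : E →L[ℝ] E) = ContinuousLinearMap.id ℝ E := by
  have hopen : IsOpen (extChartAt I p).target := isOpen_extChartAt_target p
  have hd : MDifferentiableAt 𝓘(ℝ, E) I (extChartAt I p).symm x :=
    ((contMDiffOn_extChartAt_symm (n := ∞) p).contMDiffAt (hopen.mem_nhds hx)).mdifferentiableAt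
      (by simp)
  have hev : writtenInExtChartAt 𝓘(ℝ, E) I x (extChartAt I p).symm =ᶠ[𝓝 x] id := by
    filter_upwards [hopen.mem_nhds hx] with z hz
    change extChartAt I ((extChartAt I p).symm x) ((extChartAt I p).symm z) = z
    rw [hchart, (extChartAt I p).right_inv hz]
  have hfd : fderivWithin ℝ (writtenInExtChartAt 𝓘(ℝ, E) I x (extChartAt I p).symm)
      (Set.range 𝓘(ℝ, E)) (extChartAt 𝓘(ℝ, E) x x) = ContinuousLinearMap.id ℝ E := by
    simp only [modelWithCornersSelf_coe, Set.range_id, fderivWithin_univ,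
      extChartAt_model_space_eq_id, PartialEquiv.refl_coe, id_eq]
    rw [hev.fderiv_eq]
    exact fderiv_id
  exact hd.mfderiv.trans hfd

theorem coordMetric_eq_of_chart_eq [I.Boundaryless] [IsManifold I ∞ M] (g : BilinField I M) {p : M}
    {x : E} (hx : x ∈ (extChartAt I p).target)
    (hchart : extChartAt I ((extChartAt I p).symm x) = extChartAt I p) :
    coordMetric g p x = (g ((extChartAt I p).symm x) : E →L[ℝ] E →L[ℝ] ℝ) := by
  ext u v
  have h := mfderiv_extChartAt_symm_eq_id hx hchart
  simp only [coordMetric, h, pullbackForm]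
  rfl

theorem coordMetric_self [I.Boundaryless] [IsManifold I ∞ M] (g : BilinField I M) (p : M) :
    coordMetric g p (extChartAt I p p) = (g p : E →L[ℝ] E →L[ℝ] ℝ) := by
  rw [coordMetric_eq_of_chart_eq g (mem_extChartAt_target p) (by rw [extChartAt_to_inv])]
  have : ∀ q, q = p → (g q : E →L[ℝ] E →L[ℝ] ℝ) = g p := by rintro _ rfl; rfl
  exact this _ (extChartAt_to_inv p)

/-- The Ricci tensor may be computed from any local expression of the metric in the preferred
chart. -/
theorem ricci_eq_trace_curvature (g : BilinField I M) (p : M) {G : E → E →L[ℝ] E →L[ℝ] ℝ}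
    (hG : coordMetric g p =ᶠ[𝓝 (extChartAt I p p)] G) (v w : E) :
    ricci g p v w = LinearMap.trace ℝ E (curvature G (extChartAt I p p) v w : E →ₗ[ℝ] E) := by
  rw [← curvature_congr hG]
  rfl

end Charts

section RiemannianChart

variable {E M : Type*} [NormedAddCommGroup E] [NormedSpace ℝ E] [FiniteDimensional ℝ E]
  [TopologicalSpace M] [ChartedSpace E M] [IsManifold 𝓘(ℝ, E) ∞ M]
  (g : Bundle.ContMDiffRiemannianMetric 𝓘(ℝ, E) ∞ E (fun p : M => TangentSpace 𝓘(ℝ, E) p))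

/-- A smooth Riemannian metric, given as a smooth section of the bundle of bilinear forms, has
smooth coefficients in the preferred chart. -/
theorem contDiffAt_coordMetric (p : M) :
    ContDiffAt ℝ ∞ (coordMetric (I := 𝓘(ℝ, E)) g.inner p) (extChartAt 𝓘(ℝ, E) p p) := by
  have hopen : IsOpen (extChartAt 𝓘(ℝ, E) p).target := isOpen_extChartAt_target p
  have hmem := hopen.mem_nhds (mem_extChartAt_target (I := 𝓘(ℝ, E)) p)
  have hφ := contMDiffOn_extChartAt_symm (I := 𝓘(ℝ, E)) (n := ∞) p
  -- the coordinate vector fields, as smooth maps into the tangent bundle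
  have hfield : ∀ u : E, ContMDiffAt 𝓘(ℝ, E) (𝓘(ℝ, E)).tangent ∞
      (fun x : E => (⟨(extChartAt 𝓘(ℝ, E) p).symm x,
        mfderiv 𝓘(ℝ, E) 𝓘(ℝ, E) (extChartAt 𝓘(ℝ, E) p).symm x u⟩ : TangentBundle 𝓘(ℝ, E) M))
      (extChartAt 𝓘(ℝ, E) p p) := by
    intro u
    have h1 := hφ.contMDiffOn_tangentMapWithin (m := ∞) (by simp) hopen.uniqueMDiffOn
    have h2 : ContMDiff 𝓘(ℝ, E) (𝓘(ℝ, E)).tangent ∞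
        (fun x : E => (⟨x, u⟩ : TangentBundle 𝓘(ℝ, E) E)) :=
      (contMDiff_vectorSpace_iff_contDiff (V := fun _ : E => (u : E))).2 contDiff_const
    have h3 := (h1.comp h2.contMDiffOn (s := (extChartAt 𝓘(ℝ, E) p).target)
      (fun x hx => hx)).contMDiffAt hmem
    refine h3.congr_of_eventuallyEq ?_
    filter_upwards [hmem] with x hx
    simp only [Function.comp, tangentMapWithin, mfderivWithin_of_isOpen hopen hx]
  refine contDiffAt_of_clm_apply fun u => contDiffAt_of_clm_apply fun v => ?_
  have hbase : ContMDiffAt 𝓘(ℝ, E) 𝓘(ℝ, E) ∞ (extChartAt 𝓘(ℝ, E) p).symm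
      (extChartAt 𝓘(ℝ, E) p p) := hφ.contMDiffAt hmem
  have h : ContMDiffAt 𝓘(ℝ, E) (𝓘(ℝ, E).prod 𝓘(ℝ, ℝ)) ∞
      (fun x : E => Bundle.TotalSpace.mk' ℝ (E := Bundle.Trivial M ℝ)
        ((extChartAt 𝓘(ℝ, E) p).symm x)
        (g.inner ((extChartAt 𝓘(ℝ, E) p).symm x)
          (mfderiv 𝓘(ℝ, E) 𝓘(ℝ, E) (extChartAt 𝓘(ℝ, E) p).symm x u)
          (mfderiv 𝓘(ℝ, E) 𝓘(ℝ, E) (extChartAt 𝓘(ℝ, E) p).symm x v)))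
      (extChartAt 𝓘(ℝ, E) p p) := by
    apply ContMDiffAt.clm_bundle_apply₂ (F₁ := E) (F₂ := E)
    · exact g.contMDiff.contMDiffAt.comp _ hbase
    · exact hfield u
    · exact hfield v
  simp only [Bundle.contMDiffAt_totalSpace] at h
  exact h.2.contDiffAt

theorem isInvertible_coordMetric (p : M) :
    (coordMetric (I := 𝓘(ℝ, E)) g.inner p (extChartAt 𝓘(ℝ, E) p p)).IsInvertible := by
  rw [coordMetric_self]
  refine isInvertible_of_nondegenerate fun u hu => ?_
  by_contra h0
  have hpos := g.pos p u h0
  have h1 : g.inner p u u = 0 := congrArg (fun φ : E →L[ℝ] ℝ => φ u) hu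
  exact absurd h1 hpos.ne'

end RiemannianChart

/-! ### Functions on an open subset of the line -/

section Line

variable (J : TopologicalSpace.Opens ℝ)

theorem coordMetric_opens_real (B : BilinField 𝓘(ℝ, ℝ) J) (t : J) {x : ℝ}
    (hx : x ∈ (extChartAt 𝓘(ℝ, ℝ) t).target) :
    coordMetric B t x = (B ((extChartAt 𝓘(ℝ, ℝ) t).symm x) : ℝ →L[ℝ] ℝ →L[ℝ] ℝ) :=
  coordMetric_eq_of_chart_eq B hx rfl

variable {J} {σ : J → ℝ}

theorem contDiffAt_chart_opens_real (hσ : ContMDiff 𝓘(ℝ, ℝ) 𝓘(ℝ, ℝ) ∞ σ) (t : J) :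
    ContDiffAt ℝ ∞ (σ ∘ (extChartAt 𝓘(ℝ, ℝ) t).symm) (extChartAt 𝓘(ℝ, ℝ) t t) :=
  (hσ.contMDiffAt.comp _ ((contMDiffOn_extChartAt_symm (I := 𝓘(ℝ, ℝ)) (n := ∞) t).contMDiffAt
    ((isOpen_extChartAt_target t).mem_nhds (mem_extChartAt_target t)))).contDiffAt

/-- On `(J, -dt²)`, `σ^⋄ = -(σ σ'' + (m - 1) σ'²)`. -/
theorem diamond_minusDtSq (hσ : ContMDiff 𝓘(ℝ, ℝ) 𝓘(ℝ, ℝ) ∞ σ) (m : ℕ) (t : J) :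
    diamond (minusDtSq J) m σ t
      = -(σ t * deriv (deriv (σ ∘ (extChartAt 𝓘(ℝ, ℝ) t).symm)) (extChartAt 𝓘(ℝ, ℝ) t t)
        + ((m : ℝ) - 1)
          * deriv (σ ∘ (extChartAt 𝓘(ℝ, ℝ) t).symm) (extChartAt 𝓘(ℝ, ℝ) t t) ^ 2) := by
  set F := σ ∘ (extChartAt 𝓘(ℝ, ℝ) t).symm with hF
  set x := extChartAt 𝓘(ℝ, ℝ) t t with hx
  have hFs : ContDiffAt ℝ ∞ F x := contDiffAt_chart_opens_real hσ t
  have hinv : (-(ContinuousLinearMap.mul ℝ ℝ)).IsInvertible :=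
    isInvertible_of_nondegenerate fun u hu => by
      simpa using congrArg (fun φ : ℝ →L[ℝ] ℝ => φ 1) hu
  -- the metric `-dt²` identifies a covector `φ` with `-φ 1`
  have hsharp : ∀ φ : ℝ →L[ℝ] ℝ, (-(ContinuousLinearMap.mul ℝ ℝ)).inverse φ = -φ 1 := by
    intro φ
    rw [hinv.inverse_apply_eq]
    ext; simp
  have hmf : (mfderiv 𝓘(ℝ, ℝ) 𝓘(ℝ, ℝ) σ t : ℝ →L[ℝ] ℝ) = fderiv ℝ F x := by
    have hfd : fderivWithin ℝ (writtenInExtChartAt 𝓘(ℝ, ℝ) 𝓘(ℝ, ℝ) t σ)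
        (Set.range 𝓘(ℝ, ℝ)) x = fderiv ℝ F x := by
      simp only [modelWithCornersSelf_coe, Set.range_id, fderivWithin_univ]
      rfl
    exact (hσ.mdifferentiableAt (by simp)).mfderiv.trans hfd
  have hgrad : (gradient (minusDtSq J) σ t : ℝ) = -deriv F x := by
    change (-(ContinuousLinearMap.mul ℝ ℝ)).inverse
      (mfderiv 𝓘(ℝ, ℝ) 𝓘(ℝ, ℝ) σ t : ℝ →L[ℝ] ℝ) = _
    rw [hmf, hsharp]
    rfl
  have hconst : coordMetric (minusDtSq J) t =ᶠ[𝓝 x] fun _ => -(ContinuousLinearMap.mul ℝ ℝ) := by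
    filter_upwards [(isOpen_extChartAt_target t).mem_nhds (mem_extChartAt_target t)] with z hz
    exact coordMetric_opens_real J _ t hz
  have hΓ : christoffel (coordMetric (minusDtSq J) t) x = 0 := by
    ext
    simp [christoffel_apply, christoffelFirst, hconst.fderiv_eq]
  have hlap : laplacian (minusDtSq J) σ t = -deriv (deriv F) x := by
    have hdd : fderiv ℝ (fderiv ℝ F) x 1 1 = deriv (deriv F) x := by
      have h2 : DifferentiableAt ℝ (fderiv ℝ F) x :=
        (hFs.fderiv_right (m := 1) (by norm_cast)).differentiableAt one_ne_zero
      have h3 := (h2.hasFDerivAt.clm_apply (hasFDerivAt_const (1 : ℝ) x)).fderiv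
      have h4 : deriv (deriv F) x = fderiv ℝ (fun y => fderiv ℝ F y 1) x 1 := rfl
      rw [h4, h3]; simp
    have hop : ((minusDtSq J t : ℝ →L[ℝ] ℝ →L[ℝ] ℝ).inverse ∘L hessian (minusDtSq J) σ t
        : ℝ →L[ℝ] ℝ).toLinearMap = (-deriv (deriv F) x) • LinearMap.id := by
      ext
      change (-(ContinuousLinearMap.mul ℝ ℝ)).inverse (hessian (minusDtSq J) σ t 1) = _
      rw [hsharp]
      simp only [hessian]
      rw [← hx, ← hF, hΓ]
      rw [← hdd]
      simp
    change LinearMap.trace ℝ ℝ ((minusDtSq J t : ℝ →L[ℝ] ℝ →L[ℝ] ℝ).inverse ∘L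
      hessian (minusDtSq J) σ t : ℝ →L[ℝ] ℝ).toLinearMap = _
    rw [hop]; simp
  have hgg : minusDtSq J t (gradient (minusDtSq J) σ t) (gradient (minusDtSq J) σ t)
      = -deriv F x ^ 2 := by
    change (-(ContinuousLinearMap.mul ℝ ℝ)) (gradient (minusDtSq J) σ t : ℝ)
      (gradient (minusDtSq J) σ t : ℝ) = _
    rw [hgrad]; simp; ring
  rw [diamond, hlap, hgg]
  ring

end Line

/-! ### The Ricci curvature of the space-time -/

section Spacetime

theorem spacetimeMetric_apply {E M : Type*} [NormedAddCommGroup E] [NormedSpace ℝ E]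
    [TopologicalSpace M] [ChartedSpace E M] {J : TopologicalSpace.Opens ℝ}
    (g : BilinField 𝓘(ℝ, E) M) (f : M → ℝ) (σ : J → ℝ) (q : J × M)
    (U V : ℝ × E) :
    (spacetimeMetric J g f σ q : ℝ × E →L[ℝ] ℝ × E →L[ℝ] ℝ) U V
      = -(f q.2) ^ 2 * (U.1 * V.1) + σ q.1 ^ 2 * (g q.2 : E →L[ℝ] E →L[ℝ] ℝ) U.2 V.2 := by
  change f q.2 ^ 2 * -(U.1 * V.1) + σ q.1 ^ 2 * (g q.2 : E →L[ℝ] E →L[ℝ] ℝ) U.2 V.2 = _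
  ring

variable {E M : Type*} [NormedAddCommGroup E] [NormedSpace ℝ E]
  [TopologicalSpace M] [ChartedSpace E M] [IsManifold 𝓘(ℝ, E) ∞ M]
  {J : TopologicalSpace.Opens ℝ}

/-- In the product chart, the space-time metric with constant `f` is `warpedModel` of the coordinate
expressions of `σ` and `g`. -/
theorem coordMetric_spacetimeMetric (g : BilinField 𝓘(ℝ, E) M) {f : M → ℝ} {c : ℝ}
    (hf : ∀ p, f p = c) (σ : J → ℝ) (t : J) (p : M) {y : ℝ × E}
    (hy : y ∈ (extChartAt (𝓘(ℝ, ℝ).prod 𝓘(ℝ, E)) (t, p)).target) :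
    coordMetric (spacetimeMetric J g f σ) (t, p) y
      = warpedModel c (σ ∘ (extChartAt 𝓘(ℝ, ℝ) t).symm) (coordMetric g p) y := by
  rw [extChartAt_prod, PartialEquiv.prod_target] at hy
  have h1 := mfderiv_extChartAt_symm_eq_id (I := 𝓘(ℝ, ℝ)) (p := t) hy.1 rfl
  have hm1 : MDifferentiableAt 𝓘(ℝ, ℝ) 𝓘(ℝ, ℝ) (extChartAt 𝓘(ℝ, ℝ) t).symm y.1 :=
    ((contMDiffOn_extChartAt_symm (n := ∞) t).contMDiffAt
      ((isOpen_extChartAt_target t).mem_nhds hy.1)).mdifferentiableAt (by simp)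
  have hm2 : MDifferentiableAt 𝓘(ℝ, E) 𝓘(ℝ, E) (extChartAt 𝓘(ℝ, E) p).symm y.2 :=
    ((contMDiffOn_extChartAt_symm (n := ∞) p).contMDiffAt
      ((isOpen_extChartAt_target p).mem_nhds hy.2)).mdifferentiableAt (by simp)
  have h2 := mfderiv_prodMap (p := y) hm1 hm2
  set A : ℝ × E →L[ℝ] ℝ × E := mfderiv 𝓘(ℝ, ℝ × E) (𝓘(ℝ, ℝ).prod 𝓘(ℝ, E))
      (extChartAt (𝓘(ℝ, ℝ).prod 𝓘(ℝ, E)) (t, p)).symm y with hA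
  have h3 : A = (ContinuousLinearMap.id ℝ ℝ).prodMap
      (mfderiv 𝓘(ℝ, E) 𝓘(ℝ, E) (extChartAt 𝓘(ℝ, E) p).symm y.2 : E →L[ℝ] E) := by
    rw [hA, ← h1, extChartAt_prod, modelWithCornersSelf_prod, ← chartedSpaceSelf_prod]
    exact h2
  refine ContinuousLinearMap.ext fun U => ContinuousLinearMap.ext fun V => ?_
  have h4 : coordMetric (spacetimeMetric J g f σ) (t, p) y U V
      = (spacetimeMetric J g f σ ((extChartAt 𝓘(ℝ, ℝ) t).symm y.1, (extChartAt 𝓘(ℝ, E) p).symm y.2)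
        : ℝ × E →L[ℝ] ℝ × E →L[ℝ] ℝ) (A U) (A V) := rfl
  rw [h4, spacetimeMetric_apply, warpedModel_apply, h3, hf]
  rfl

theorem coordMetric_spacetimeMetric_eventuallyEq (g : BilinField 𝓘(ℝ, E) M) {f : M → ℝ} {c : ℝ}
    (hf : ∀ p, f p = c) (σ : J → ℝ) (t : J) (p : M) :
    coordMetric (spacetimeMetric J g f σ) (t, p)
      =ᶠ[𝓝 (extChartAt (𝓘(ℝ, ℝ).prod 𝓘(ℝ, E)) (t, p) (t, p))]
        warpedModel c (σ ∘ (extChartAt 𝓘(ℝ, ℝ) t).symm) (coordMetric g p) := by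
  filter_upwards [(isOpen_extChartAt_target (I := 𝓘(ℝ, ℝ).prod 𝓘(ℝ, E)) (t, p)).mem_nhds
    (mem_extChartAt_target (t, p))] with y hy
  exact coordMetric_spacetimeMetric g hf σ t p hy

section Ricci

variable [FiniteDimensional ℝ E]
  (g : Bundle.ContMDiffRiemannianMetric 𝓘(ℝ, E) ∞ E (fun p : M => TangentSpace 𝓘(ℝ, E) p))
  {f : M → ℝ} {c : ℝ} {σ : J → ℝ}

/-- `Ric(∂_t, ∂_t) = -n σ'' / σ` for the metric `-c² dt² + σ² g`. -/
theorem ricci_spacetimeMetric_line (hf : ∀ p, f p = c) (hc : c ≠ 0)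
    (hσ : ContMDiff 𝓘(ℝ, ℝ) 𝓘(ℝ, ℝ) ∞ σ) (hσ0 : ∀ t, σ t ≠ 0) (t : J) (p : M) :
    ricci (spacetimeMetric J g.inner f σ) (t, p) ((1, 0) : ℝ × E) ((1, 0) : ℝ × E)
      = -(Module.finrank ℝ E *
        (deriv (deriv (σ ∘ (extChartAt 𝓘(ℝ, ℝ) t).symm)) (extChartAt 𝓘(ℝ, ℝ) t t) / σ t)) := by
  have h := trace_curvature_warpedModel_line (y := (extChartAt 𝓘(ℝ, ℝ) t t, extChartAt 𝓘(ℝ, E) p p))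
    hc (hσ0 _) (contDiffAt_chart_opens_real hσ t) (contDiffAt_coordMetric g p)
    (isInvertible_coordMetric g p)
  refine (ricci_eq_trace_curvature _ _
    (coordMetric_spacetimeMetric_eventuallyEq g.inner hf σ t p) _ _).trans (h.trans ?_)
  simp only [Function.comp, extChartAt_to_inv]

/-- `Ric(v, w) = Ric_M(v, w) - σ^⋄ / c² g(v, w)` on vectors tangent to `M`, for the metric
`-c² dt² + σ² g`. -/
theorem ricci_spacetimeMetric_fibre (hf : ∀ p, f p = c) (hc : c ≠ 0)
    (hσ : ContMDiff 𝓘(ℝ, ℝ) 𝓘(ℝ, ℝ) ∞ σ) (hσ0 : ∀ t, σ t ≠ 0) (t : J) (p : M) (v w : E) :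
    ricci (spacetimeMetric J g.inner f σ) (t, p) ((0, v) : ℝ × E) ((0, w) : ℝ × E)
      = ricci (I := 𝓘(ℝ, E)) (M := M) g.inner p v w
        - diamond (minusDtSq J) (Module.finrank ℝ E) σ t / c ^ 2
          * (g.inner p : E →L[ℝ] E →L[ℝ] ℝ) v w := by
  have h := trace_curvature_warpedModel_fibre
    (y := (extChartAt 𝓘(ℝ, ℝ) t t, extChartAt 𝓘(ℝ, E) p p))
    hc (hσ0 _) (contDiffAt_chart_opens_real hσ t) (contDiffAt_coordMetric g p)
    (isInvertible_coordMetric g p) v w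
  refine (ricci_eq_trace_curvature _ _
    (coordMetric_spacetimeMetric_eventuallyEq g.inner hf σ t p) _ _).trans (h.trans ?_)
  rw [diamond_minusDtSq hσ, coordMetric_self,
    ← ricci_eq_trace_curvature (I := 𝓘(ℝ, E)) g.inner p Filter.EventuallyEq.rfl]
  simp only [Function.comp, extChartAt_to_inv]
  rw [neg_div, neg_mul, sub_neg_eq_add]
  rfl

end Ricci

end Spacetime

end WarpedGeometry

open WarpedGeometry in
theorem mainTheorem6
    {E M : Type*} [NormedAddCommGroup E] [NormedSpace ℝ E] [FiniteDimensional ℝ E] [Nontrivial E]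
    [TopologicalSpace M] [ChartedSpace E M] [IsManifold 𝓘(ℝ, E) ∞ M]
    (J : TopologicalSpace.Opens ℝ) (hJ : IsConnected (J : Set ℝ))
    (g : Bundle.ContMDiffRiemannianMetric 𝓘(ℝ, E) ∞ E (fun p : M => TangentSpace 𝓘(ℝ, E) p))
    (f : M → ℝ) (hf : ContMDiff 𝓘(ℝ, E) 𝓘(ℝ, ℝ) ∞ f) (hfpos : ∀ p, 0 < f p)
    (σ : J → ℝ) (hσ : ContMDiff 𝓘(ℝ, ℝ) 𝓘(ℝ, ℝ) ∞ σ) (hσpos : ∀ t, 0 < σ t)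
    (h : J → ℝ) (hh : ContMDiff 𝓘(ℝ, ℝ) 𝓘(ℝ, ℝ) ∞ h)
    (ζ : VecField 𝓘(ℝ, E) M) (hζ : ζ.IsSmooth)
    (lam : ℝ) (ρ : J × M → ℝ)
    (hsol : IsRicciSoliton (spacetimeMetric J g.inner f σ) (sumLift (hdt h) ζ) lam)
    (hconf : IsConformal (spacetimeMetric J g.inner f σ) (sumLift (hdt h) ζ)
      (fun q => 2 * ρ q))
    (hconst : ∃ c : ℝ, ∀ p, f p = c) :
    ∃ μ : ℝ, IsEinstein (I := 𝓘(ℝ, E)) (M := M) g.inner μ ∧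
      ∀ (t : J) (p : M),
        μ = (lam - ρ (t, p)) * σ t ^ 2
          + diamond (minusDtSq J) (Module.finrank ℝ E) σ t / f p ^ 2 := by
  obtain ⟨c, hc⟩ := hconst
  rcases isEmpty_or_nonempty M with hM | ⟨⟨p₀⟩⟩
  · exact ⟨0, fun p => hM.elim p, fun _ p => hM.elim p⟩
  obtain ⟨t₀, ht₀⟩ := hJ.nonempty
  have hc0 : c ≠ 0 := hc p₀ ▸ (hfpos p₀).ne'
  have hσ0 : ∀ t, σ t ≠ 0 := fun t => (hσpos t).ne'
  -- the conformal equation removes the Lie derivative from the soliton equation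
  have hric : ∀ (t : J) (p : M) (U V : ℝ × E),
      ricci (spacetimeMetric J g.inner f σ) (t, p) U V
        = (lam - ρ (t, p)) * (-c ^ 2 * (U.1 * V.1)
          + σ t ^ 2 * (g.inner p : E →L[ℝ] E →L[ℝ] ℝ) U.2 V.2) := by
    intro t p U V
    have h1 := hsol.2 (t, p) U V
    have h2 := hconf.2.2 (t, p) U V
    have h3 := spacetimeMetric_apply g.inner f σ (t, p) U V
    rw [hc] at h3
    rw [h2] at h1
    rw [← h3]
    linear_combination h1
  -- the `∂_t` direction shows that `lam - ρ` depends on `t` only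
  have hρ : ∀ (t : J) (p : M), ρ (t, p) = ρ (t, p₀) := by
    intro t p
    have h1 := hric t p (1, 0) (1, 0)
    have h2 := hric t p₀ (1, 0) (1, 0)
    rw [ricci_spacetimeMetric_line g hc hc0 hσ hσ0] at h1 h2
    have hz : ∀ q, (g.inner q : E →L[ℝ] E →L[ℝ] ℝ) (0 : E) (0 : E) = 0 := fun q =>
      (g.inner q (0 : E)).map_zero
    simp only [hz, mul_zero, add_zero, mul_one] at h1 h2
    linarith [mul_right_cancel₀ (neg_ne_zero.2 (pow_ne_zero 2 hc0)) (h1.symm.trans h2)]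
  have hM : ∀ (t : J) (p : M) (v w : E),
      ricci (I := 𝓘(ℝ, E)) (M := M) g.inner p v w
        = ((lam - ρ (t, p₀)) * σ t ^ 2 + diamond (minusDtSq J) (Module.finrank ℝ E) σ t / c ^ 2)
          * (g.inner p : E →L[ℝ] E →L[ℝ] ℝ) v w := by
    intro t p v w
    have h1 := hric t p (0, v) (0, w)
    rw [ricci_spacetimeMetric_fibre g hc hc0 hσ hσ0, hρ] at h1
    simp only [mul_zero, zero_add] at h1
    linear_combination h1
  refine ⟨_, fun p v w => hM ⟨t₀, ht₀⟩ p v w, fun t p => ?_⟩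
  obtain ⟨v, hv⟩ := exists_ne (0 : E)
  have hpos : (g.inner p₀ : E →L[ℝ] E →L[ℝ] ℝ) v v ≠ 0 := (g.pos p₀ v hv).ne'
  rw [hc, hρ t p]
  exact mul_right_cancel₀ hpos ((hM ⟨t₀, ht₀⟩ p₀ v v).symm.trans (hM t p₀ v v))
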